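/- Let $\Gamma_n$ ($n\ge 2$) be the set of all $(\alpha,\beta)$ with $\alpha,\beta>0$ such that $$\tfrac n2\tfrac{\pi}{\sqrt\alpha}+\tfrac n2\tfrac{\pi}{\sqrt\beta}=\pi \ \text{ if } n \text{ is even},\qquad \tfrac{n+1}2\tfrac{\pi}{\sqrt\alpha}+\tfrac{n-1}2\tfrac{\pi}{\sqrt\beta}=\pi\ \text{ if } n \text{ is odd}.$$ For $(\alpha,\beta)\in\Gamma_n$ the normalized Fučík eigenfunction $f^n_{\alpha,\beta}$ is the $C^2$-solution on $[0,\pi]$ of $$-u''=\alpha u^+-\beta u^-\ \text{ in }(0,\pi),\qquad u(0)=u(\pi)=0,$$ where $u^+=\max(u,0)$ and $u^-=\max(-u,0)$, with $u'(0)>0$ and $\sup_{[0,\pi]}|u|=1$; moreover $f^1_{1,1}(x)=\sin x$. A Fučík system is a sequence $F_{\alpha,\beta}=\{f^n_{\alpha(n),\beta(n)}\}_{n\ge1}$ with $\alpha(1)=\beta(1)=1$ and $(\alpha(n),\beta(n))\in\Gamma_n$ for every $n\ge2$. For $n\ge2$ set $$C_n(x,y)=\begin{cases}\dfrac{4(3+\pi^2)\pi}{9}\left(\dfrac{\max(\sqrt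 x,\sqrt y)}{n}-1\right)^2 & n\text{ even},\\[2mm] 4\pi\,\dfrac{n^2(n^2+1)}{(n-1)^4}\left(\dfrac{\sqrt x}{n}-1\right)^2 & n\text{ odd},\ x\ge y,\\[2mm] 5\pi\,\dfrac{n^2(n^2+1)}{(n+1)^4}\left(\dfrac{\sqrt y}{n}-1\right)^2 & n\text{ odd},\ y>x.\end{cases}$$ **Theorem.** Let $F_{\alpha,\beta}$ be a Fučík system. If $\sum_{n=2}^\infty C_n(\alpha(n),\beta(n))<\frac{\pi}{2}$, then $F_{\alpha,\beta}$ is a Riesz basis of $L^2(0,\pi)$ (with real or complex scalars). That is, the linear span of $F_{\alpha,\beta}$ is dense in $L^2(0,\pi)$, and there are constants $c,C>0$ such that $$c\sum_{n=1}^N|a_n|^2\le\Big\|\sum_{n=1}^N a_n f^n_{\alpha(n),\beta(n)}\Big\|^2_{L^2(0,\pi)}\le C\sum_{n=1}^N|a_n|^2$$ for all $N\in\mathbb N$ and all scalars $a_1,\dots,a_N$. -/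

import Mathlib

open Real Set MeasureTheory

noncomputable section

/-- `u` is a classical solution, of class `C²` on `[0, π]`, of the Dirichlet problem
`-u'' = α u⁺ - β u⁻` in `(0, π)`, `u 0 = u π = 0`. -/
structure IsFucikSolution (α β : ℝ) (u : ℝ → ℝ) : Prop where
  contDiffOn : ContDiffOn ℝ 2 u (Icc 0 π)
  equation : ∀ x ∈ Ioo 0 π, -deriv (deriv u) x = α * max (u x) 0 - β * max (-u x) 0
  left : u 0 = 0
  right : u π = 0

/-- A normalized Fučík eigenfunction: a classical solution with positive slope at `0` and with
supremum norm `1` on `[0, π]`. -/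
structure IsNormalizedFucikEigenfunction (α β : ℝ) (u : ℝ → ℝ) : Prop where
  solution : IsFucikSolution α β u
  slope_pos : 0 < derivWithin u (Icc 0 π) 0
  norm_one : IsLUB ((fun x => |u x|) '' Icc 0 π) 1

/-- The Fučík curve `Γ n`, whose eigenfunctions start with a positive bump: `n / 2` positive and
`n / 2` negative bumps for even `n`, `(n + 1) / 2` positive and `(n - 1) / 2` negative bumps for
odd `n`. -/
def fucikCurve (n : ℕ) : Set (ℝ × ℝ) :=
  {p | 0 < p.1 ∧ 0 < p.2 ∧
    if Even n then (n : ℝ) / 2 * (π / √p.1) + (n : ℝ) / 2 * (π / √p.2) = π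
    else ((n : ℝ) + 1) / 2 * (π / √p.1) + ((n : ℝ) - 1) / 2 * (π / √p.2) = π}

/-- The functions `f n`, `n ≥ 1`, form the Fučík system of the mappings `α` and `β`.
The values of `α`, `β`, `f` at the index `0` play no role. -/
structure IsFucikSystem (α β : ℕ → ℝ) (f : ℕ → ℝ → ℝ) : Prop where
  alpha_one : α 1 = 1
  beta_one : β 1 = 1
  mem_curve : ∀ n, 2 ≤ n → (α n, β n) ∈ fucikCurve n
  first : EqOn (f 1) sin (Icc 0 π)
  eigenfunction : ∀ n, 2 ≤ n → IsNormalizedFucikEigenfunction (α n) (β n) (f n)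

/-- The weights `C_n(x, y)`. -/
def fucikWeight (n : ℕ) (x y : ℝ) : ℝ :=
  if Even n then 4 * (3 + π ^ 2) * π / 9 * (max (√x) (√y) / n - 1) ^ 2
  else if y ≤ x then
    4 * π * ((n : ℝ) ^ 2 * ((n : ℝ) ^ 2 + 1) / ((n : ℝ) - 1) ^ 4) * (√x / n - 1) ^ 2
  else
    5 * π * ((n : ℝ) ^ 2 * ((n : ℝ) ^ 2 + 1) / ((n : ℝ) + 1) ^ 4) * (√y / n - 1) ^ 2

/-- A sequence in a Hilbert space is a Riesz basis if it is complete (its linear span is dense)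
and the squared norm of every finite linear combination is comparable, with uniform positive
constants, to the sum of the squared moduli of the coefficients. -/
def IsRieszBasis (𝕜 : Type*) {H : Type*} [RCLike 𝕜] [NormedAddCommGroup H]
    [InnerProductSpace 𝕜 H] (ψ : ℕ → H) : Prop :=
  (Submodule.span 𝕜 (range ψ)).topologicalClosure = ⊤ ∧
    ∃ c C : ℝ, 0 < c ∧ 0 < C ∧ ∀ (N : ℕ) (a : ℕ → 𝕜),
      c * ∑ k ∈ Finset.range N, ‖a k‖ ^ 2 ≤ ‖∑ k ∈ Finset.range N, a k • ψ k‖ ^ 2 ∧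
      ‖∑ k ∈ Finset.range N, a k • ψ k‖ ^ 2 ≤ C * ∑ k ∈ Finset.range N, ‖a k‖ ^ 2

end

/-!
A perturbation of an orthogonal basis of vectors of norm `√(π / 2)` whose squared distances to that
basis sum to less than `π / 2` is a Riesz basis, by the triangle inequality in `ℓ²`. The basis here
is `sin (n x)`; it is complete because, substituting `t = cos x`, a function orthogonal to all sines
is orthogonal to all products of a polynomial in `cos x` with `sin x`.

A Fučík eigenfunction is a chain of alternating sine arches: `(u, u')` and the explicit chain solve
the same Lipschitz first-order system. All arches start with the same slope up to sign, so the
normalization fixes that slope to be the smaller of the two frequencies. The integral of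
`u x * sin (n x)` is evaluated arch by arch, where one of the two families of arches telescopes
away, and reduces to a finite sum of sines estimated by `sin t ≥ t - t³ / 6`. Writing
`ω = n / (1 - δ)` for the larger frequency, the squared distance from `u` to `sin (n x)` is then
bounded by a multiple of `δ²`, and `δ ≤ ω / n - 1`.
-/

section HilbertSpace

variable {ι 𝕜 H : Type*} [RCLike 𝕜] [NormedAddCommGroup H] [InnerProductSpace 𝕜 H]

theorem norm_sum_smul_sq_of_orthonormal {e : ι → H} (he : Orthonormal 𝕜 e) (s : Finset ι)
    (a : ι → 𝕜) : ‖∑ k ∈ s, a k • e k‖ ^ 2 = ∑ k ∈ s, ‖a k‖ ^ 2 := by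
  have h : ((‖∑ k ∈ s, a k • e k‖ ^ 2 : ℝ) : 𝕜) = ((∑ k ∈ s, ‖a k‖ ^ 2 : ℝ) : 𝕜) := by
    push_cast
    rw [← inner_self_eq_norm_sq_to_K (𝕜 := 𝕜), he.inner_sum]
    simp only [RCLike.conj_mul]
  exact_mod_cast h

theorem norm_sum_smul_le_of_summable_sq {ε : ι → H} (hε : Summable fun k => ‖ε k‖ ^ 2)
    (s : Finset ι) (a : ι → 𝕜) :
    ‖∑ k ∈ s, a k • ε k‖ ≤ √(∑' k, ‖ε k‖ ^ 2) * √(∑ k ∈ s, ‖a k‖ ^ 2) := by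
  calc ‖∑ k ∈ s, a k • ε k‖ ≤ ∑ k ∈ s, ‖ε k‖ * ‖a k‖ :=
        norm_sum_le_of_le _ fun k _ => by rw [norm_smul, mul_comm]
    _ ≤ √(∑ k ∈ s, ‖ε k‖ ^ 2) * √(∑ k ∈ s, ‖a k‖ ^ 2) := Real.sum_mul_le_sqrt_mul_sqrt _ _ _
    _ ≤ √(∑' k, ‖ε k‖ ^ 2) * √(∑ k ∈ s, ‖a k‖ ^ 2) := by
        gcongr
        exact hε.sum_le_tsum s fun _ _ => sq_nonneg _

theorem hasSum_norm_inner_sq (b : HilbertBasis ι 𝕜 H) (g : H) :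
    HasSum (fun k => ‖inner 𝕜 (b k) g‖ ^ 2) (‖g‖ ^ 2) := by
  rw [← RCLike.hasSum_ofReal 𝕜, RCLike.ofReal_pow, ← inner_self_eq_norm_sq_to_K]
  convert! b.hasSum_inner_mul_inner g g using 2 with k
  rw [← inner_conj_symm g (b k), RCLike.conj_mul, RCLike.ofReal_pow]

/- A vector `g` orthogonal to every `ψ k` has `r ⟪b k, g⟫ = -⟪ψ k - r • b k, g⟫`, up to conjugation,
so Parseval gives `‖r‖² ‖g‖² ≤ (∑ ‖ψ k - r • b k‖²) ‖g‖²`. -/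
theorem topologicalClosure_span_eq_top_of_tsum_norm_sub_smul_sq_lt [CompleteSpace H]
    (b : HilbertBasis ι 𝕜 H) {ψ : ι → H} {r : 𝕜} (hs : Summable fun k => ‖ψ k - r • b k‖ ^ 2)
    (hlt : ∑' k, ‖ψ k - r • b k‖ ^ 2 < ‖r‖ ^ 2) :
    (Submodule.span 𝕜 (range ψ)).topologicalClosure = ⊤ := by
  rw [Submodule.topologicalClosure_eq_top_iff, Submodule.eq_bot_iff]
  intro g hg
  have hψ (k : ι) : inner 𝕜 (ψ k) g = 0 :=
    (Submodule.mem_orthogonal _ _).1 hg (ψ k) (Submodule.subset_span ⟨k, rfl⟩)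
  have hterm (k : ι) :
      ‖r‖ ^ 2 * ‖inner 𝕜 (b k) g‖ ^ 2 ≤ ‖ψ k - r • b k‖ ^ 2 * ‖g‖ ^ 2 := by
    calc ‖r‖ ^ 2 * ‖inner 𝕜 (b k) g‖ ^ 2 = ‖inner 𝕜 (ψ k - r • b k) g‖ ^ 2 := by
          rw [inner_sub_left, hψ, zero_sub, norm_neg, inner_smul_left, norm_mul, RCLike.norm_conj,
            mul_pow]
      _ ≤ ‖ψ k - r • b k‖ ^ 2 * ‖g‖ ^ 2 := by
          rw [← mul_pow]
          gcongr
          exact norm_inner_le_norm _ _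
  have hle : ‖r‖ ^ 2 * ‖g‖ ^ 2 ≤ (∑' k, ‖ψ k - r • b k‖ ^ 2) * ‖g‖ ^ 2 :=
    hasSum_le hterm ((hasSum_norm_inner_sq b g).mul_left _) (hs.hasSum.mul_right _)
  by_contra hne
  exact absurd (le_of_mul_le_mul_right hle (by positivity)) hlt.not_ge

theorem abs_norm_sum_smul_sub_le {e ψ : ι → H} (he : Orthonormal 𝕜 e) (r : 𝕜)
    (hs : Summable fun k => ‖ψ k - r • e k‖ ^ 2) (s : Finset ι) (a : ι → 𝕜) :
    |‖∑ k ∈ s, a k • ψ k‖ - ‖r‖ * √(∑ k ∈ s, ‖a k‖ ^ 2)|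
      ≤ √(∑' k, ‖ψ k - r • e k‖ ^ 2) * √(∑ k ∈ s, ‖a k‖ ^ 2) := by
  have hr : ‖∑ k ∈ s, a k • r • e k‖ = ‖r‖ * √(∑ k ∈ s, ‖a k‖ ^ 2) := by
    rw [← norm_sum_smul_sq_of_orthonormal he, Real.sqrt_sq (norm_nonneg _), ← norm_smul,
      Finset.smul_sum]
    simp only [smul_comm r]
  rw [← hr]
  refine (abs_norm_sub_norm_le _ _).trans ?_
  simp only [← Finset.sum_sub_distrib, ← smul_sub]
  exact norm_sum_smul_le_of_summable_sq hs s a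

theorem isRieszBasis_of_tsum_norm_sub_smul_sq_lt [CompleteSpace H] (b : HilbertBasis ℕ 𝕜 H)
    {ψ : ℕ → H} {r : 𝕜} (hs : Summable fun k => ‖ψ k - r • b k‖ ^ 2)
    (hlt : ∑' k, ‖ψ k - r • b k‖ ^ 2 < ‖r‖ ^ 2) : IsRieszBasis 𝕜 ψ := by
  set D := ∑' k, ‖ψ k - r • b k‖ ^ 2
  have hDr : √D < ‖r‖ := by
    simpa using Real.sqrt_lt_sqrt (tsum_nonneg fun _ => sq_nonneg _) hlt
  refine ⟨topologicalClosure_span_eq_top_of_tsum_norm_sub_smul_sq_lt b hs hlt, (‖r‖ - √D) ^ 2,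
    (‖r‖ + √D) ^ 2, by have := sub_pos.2 hDr; positivity,
    by have := (Real.sqrt_nonneg D).trans_lt hDr; positivity, fun N a => ?_⟩
  set A := ∑ k ∈ Finset.range N, ‖a k‖ ^ 2
  have hA : √A ^ 2 = A := Real.sq_sqrt (by positivity)
  obtain ⟨hlo, hhi⟩ := abs_le.1 (abs_norm_sum_smul_sub_le b.orthonormal r hs (Finset.range N) a)
  constructor
  · calc (‖r‖ - √D) ^ 2 * A = ((‖r‖ - √D) * √A) ^ 2 := by rw [mul_pow, hA]
      _ ≤ _ := pow_le_pow_left₀ (mul_nonneg (sub_pos.2 hDr).le (Real.sqrt_nonneg _))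
        (by linarith) 2
  · calc _ ≤ ((‖r‖ + √D) * √A) ^ 2 := pow_le_pow_left₀ (norm_nonneg _) (by linarith) 2
      _ = (‖r‖ + √D) ^ 2 * A := by rw [mul_pow, hA]

end HilbertSpace

section SineCompleteness

variable {E : Type*} [NormedAddCommGroup E] [NormedSpace ℝ E]

theorem integrable_smul_Ioo_of_continuous {a b : ℝ} {h : ℝ → ℝ} {g : ℝ → E} (hh : Continuous h)
    (hg : Integrable g (volume.restrict (Ioo a b))) :
    Integrable (fun x => h x • g x) (volume.restrict (Ioo a b)) :=
  IntegrableOn.continuousOn_smul_of_subset hh.continuousOn hg isCompact_Icc measurableSet_Ioo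
    Ioo_subset_Icc_self

theorem integral_cos_pow_mul_sin_smul_eq_zero {g : ℝ → E}
    (hg : Integrable g (volume.restrict (Ioo 0 π)))
    (h : ∀ n : ℕ, ∫ x in Ioo 0 π, sin (n * x) • g x = 0) (k n : ℕ) :
    ∫ x in Ioo 0 π, (cos x ^ k * sin (n * x)) • g x = 0 := by
  induction k generalizing n with
  | zero => simpa only [pow_zero, one_mul] using h n
  | succ k ih =>
    rcases n with _ | n
    · simp
    have product_to_sum (x : ℝ) : (cos x ^ (k + 1) * sin ((n + 1 : ℕ) * x)) • g x
        = (1 / 2 : ℝ) • ((cos x ^ k * sin ((n + 2 : ℕ) * x)) • g x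
          + (cos x ^ k * sin (n * x)) • g x) := by
      have hadd : ((n + 2 : ℕ) : ℝ) * x = ((n + 1 : ℕ) : ℝ) * x + x := by push_cast; ring
      have hsub : (n : ℝ) * x = ((n + 1 : ℕ) : ℝ) * x - x := by push_cast; ring
      rw [← add_smul, smul_smul, hadd, hsub, sin_add, sin_sub]
      congr 1
      ring
    simp_rw [product_to_sum]
    rw [integral_smul, integral_add (integrable_smul_Ioo_of_continuous (by fun_prop) hg)
      (integrable_smul_Ioo_of_continuous (by fun_prop) hg), ih, ih, add_zero, smul_zero]

theorem integral_polynomial_cos_mul_sin_smul_eq_zero {g : ℝ → E}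
    (hg : Integrable g (volume.restrict (Ioo 0 π)))
    (h : ∀ n : ℕ, ∫ x in Ioo 0 π, sin (n * x) • g x = 0) (p : Polynomial ℝ) :
    ∫ x in Ioo 0 π, (p.eval (cos x) * sin x) • g x = 0 := by
  induction p using Polynomial.induction_on' with
  | add p q hp hq =>
    simp_rw [Polynomial.eval_add, add_mul, add_smul]
    rw [integral_add (integrable_smul_Ioo_of_continuous (by fun_prop) hg)
      (integrable_smul_Ioo_of_continuous (by fun_prop) hg), hp, hq, add_zero]
  | monomial k a =>
    simp_rw [Polynomial.eval_monomial, mul_assoc, mul_smul a]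
    rw [integral_smul]
    simpa using Or.inr (integral_cos_pow_mul_sin_smul_eq_zero hg h k 1)

/- On `[0, π]` a continuous `φ` is a continuous function of `cos x`, namely `φ ∘ arccos`, hence a
uniform limit of polynomials in `cos x`. -/
theorem integral_continuous_mul_sin_smul_eq_zero {g : ℝ → E}
    (hg : Integrable g (volume.restrict (Ioo 0 π)))
    (h : ∀ n : ℕ, ∫ x in Ioo 0 π, sin (n * x) • g x = 0) {φ : ℝ → ℝ} (hφ : Continuous φ) :
    ∫ x in Ioo 0 π, (φ x * sin x) • g x = 0 := by
  set M := ∫ x in Ioo 0 π, ‖g x‖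
  have hM : 0 < M + 1 :=
    add_pos_of_nonneg_of_pos (integral_nonneg fun _ => norm_nonneg _) one_pos
  suffices ∀ ε > 0, ‖∫ x in Ioo 0 π, (φ x * sin x) • g x‖ ≤ ε * M by
    rw [← norm_le_zero_iff]
    refine le_of_forall_pos_le_add fun ε hε => ?_
    calc _ ≤ ε / (M + 1) * M := this _ (div_pos hε hM)
      _ = ε * (M / (M + 1)) := by ring
      _ ≤ ε * 1 := by gcongr; exact (div_le_one hM).2 (by linarith)
      _ = 0 + ε := by ring
  intro ε hε
  obtain ⟨p, hp⟩ := exists_polynomial_near_of_continuousOn (-1) 1 (fun y => φ (arccos y))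
    (hφ.comp continuous_arccos).continuousOn ε hε
  have hclose : ∀ x ∈ Ioo 0 π, |(φ x - p.eval (cos x)) * sin x| ≤ ε := fun x hx => by
    have hpx := hp (cos x) ⟨neg_one_le_cos x, cos_le_one x⟩
    rw [arccos_cos hx.1.le hx.2.le, abs_sub_comm] at hpx
    rw [abs_mul]
    exact (mul_le_of_le_one_right (abs_nonneg _) (abs_sin_le_one x)).trans hpx.le
  calc ‖∫ x in Ioo 0 π, (φ x * sin x) • g x‖
      = ‖∫ x in Ioo 0 π, ((φ x - p.eval (cos x)) * sin x) • g x‖ := by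
        simp_rw [sub_mul, sub_smul]
        rw [integral_sub (integrable_smul_Ioo_of_continuous (by fun_prop) hg)
          (integrable_smul_Ioo_of_continuous (by fun_prop) hg),
          integral_polynomial_cos_mul_sin_smul_eq_zero hg h p, sub_zero]
    _ ≤ ∫ x in Ioo 0 π, ε * ‖g x‖ := by
        refine norm_integral_le_of_norm_le (hg.norm.const_mul _) ?_
        filter_upwards [ae_restrict_mem measurableSet_Ioo] with x hx
        rw [norm_smul, Real.norm_eq_abs]
        gcongr
        exact hclose x hx
    _ = ε * M := integral_const_mul _ _

theorem ae_eq_zero_of_integral_sin_smul_eq_zero [CompleteSpace E] {g : ℝ → E}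
    (hg : Integrable g (volume.restrict (Ioo 0 π)))
    (h : ∀ n : ℕ, ∫ x in Ioo 0 π, sin (n * x) • g x = 0) :
    g =ᵐ[volume.restrict (Ioo 0 π)] 0 := by
  have hsin : ∀ᵐ x ∂(volume.restrict (Ioo 0 π)), sin x • g x = 0 := by
    refine ae_eq_zero_of_integral_contDiff_smul_eq_zero
      (integrable_smul_Ioo_of_continuous continuous_sin hg).locallyIntegrable fun φ hφ _ => ?_
    simpa only [smul_smul] using integral_continuous_mul_sin_smul_eq_zero hg h hφ.continuous
  filter_upwards [hsin, ae_restrict_mem measurableSet_Ioo] with x hx hx'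
  exact (smul_eq_zero.1 hx).resolve_left (sin_pos_of_pos_of_lt_pi hx'.1 hx'.2).ne'

end SineCompleteness

section RealFunctionsInL2

variable {X 𝕜 : Type*} [RCLike 𝕜] [MeasurableSpace X] {μ : Measure X} {u v : X → ℝ}

theorem inner_toLp_ofReal (hu : MemLp (fun x => (u x : 𝕜)) 2 μ)
    (hv : MemLp (fun x => (v x : 𝕜)) 2 μ) :
    inner 𝕜 hu.toLp hv.toLp = ((∫ x, u x * v x ∂μ : ℝ) : 𝕜) := by
  rw [L2.inner_def, ← integral_ofReal]
  refine integral_congr_ae ?_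
  filter_upwards [hu.coeFn_toLp, hv.coeFn_toLp] with x hux hvx
  rw [hux, hvx, RCLike.inner_apply, RCLike.conj_ofReal, ← RCLike.ofReal_mul, mul_comm]

theorem norm_toLp_ofReal_sub_sq (hu : MemLp (fun x => (u x : 𝕜)) 2 μ)
    (hv : MemLp (fun x => (v x : 𝕜)) 2 μ) :
    ‖hu.toLp - hv.toLp‖ ^ 2 = ∫ x, (u x - v x) ^ 2 ∂μ := by
  have hsub : MemLp (fun x => ((u x - v x : ℝ) : 𝕜)) 2 μ := by
    simpa only [RCLike.ofReal_sub, Pi.sub_def] using hu.sub hv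
  have hdiff : hu.toLp - hv.toLp = hsub.toLp := by
    rw [← MemLp.toLp_sub]
    simp only [RCLike.ofReal_sub, Pi.sub_def]
  rw [hdiff, ← inner_self_eq_norm_sq (𝕜 := 𝕜), inner_toLp_ofReal, RCLike.ofReal_re]
  simp only [sq]

theorem memLp_ofReal_of_continuousOn {u : ℝ → ℝ} {a b : ℝ} {p : ENNReal}
    (hu : ContinuousOn u (Icc a b)) :
    MemLp (fun x => (u x : 𝕜)) p (volume.restrict (Ioo a b)) := by
  obtain ⟨C, hC⟩ := isCompact_Icc.exists_bound_of_continuousOn hu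
  have hmeas : AEStronglyMeasurable (fun x => (u x : 𝕜)) (volume.restrict (Ioo a b)) :=
    (RCLike.continuous_ofReal.comp_continuousOn
      (hu.mono Ioo_subset_Icc_self)).aestronglyMeasurable measurableSet_Ioo
  refine MemLp.of_bound hmeas C ?_
  filter_upwards [ae_restrict_mem measurableSet_Ioo] with x hx
  rw [RCLike.norm_ofReal]
  exact hC x (Ioo_subset_Icc_self hx)

end RealFunctionsInL2

section SineBasis

variable (𝕜 : Type*) [RCLike 𝕜]

theorem integral_cos_int_mul_eq_zero {m : ℤ} (hm : m ≠ 0) : ∫ x in 0..π, cos (m * x) = 0 := by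
  rw [intervalIntegral.integral_comp_mul_left cos (Int.cast_ne_zero.2 hm), integral_cos,
    sin_int_mul_pi]
  simp

theorem integral_sin_mul_sin_nat (i j : ℕ) :
    ∫ x in 0..π, sin ((i + 1 : ℕ) * x) * sin ((j + 1 : ℕ) * x) = if i = j then π / 2 else 0 := by
  have product_to_sum (x : ℝ) : sin ((i + 1 : ℕ) * x) * sin ((j + 1 : ℕ) * x)
      = (1 / 2) * (cos (((i : ℤ) - j : ℤ) * x) - cos (((i : ℤ) + j + 2 : ℤ) * x)) := by
    have hsub : (((i : ℤ) - j : ℤ) : ℝ) * x = (i + 1 : ℕ) * x - (j + 1 : ℕ) * x := by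
      push_cast; ring
    have hadd : (((i : ℤ) + j + 2 : ℤ) : ℝ) * x = (i + 1 : ℕ) * x + (j + 1 : ℕ) * x := by
      push_cast; ring
    rw [hsub, hadd, cos_add, cos_sub]
    ring
  simp_rw [product_to_sum]
  rw [intervalIntegral.integral_const_mul, intervalIntegral.integral_sub
    (Continuous.intervalIntegrable (by fun_prop) _ _)
    (Continuous.intervalIntegrable (by fun_prop) _ _),
    integral_cos_int_mul_eq_zero (m := (i : ℤ) + j + 2) (by omega)]
  split_ifs with hij
  · simp only [hij, sub_self, Int.cast_zero, zero_mul, cos_zero, intervalIntegral.integral_const]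
    simp only [sub_zero, smul_eq_mul]
    ring
  · rw [integral_cos_int_mul_eq_zero (by omega), sub_zero, mul_zero]

theorem memLp_sin_nat_mul (n : ℕ) :
    MemLp (fun x : ℝ => (sin (n * x) : 𝕜)) 2 (volume.restrict (Ioo 0 π)) :=
  memLp_ofReal_of_continuousOn (by fun_prop)

/-- The unnormalized sine `x ↦ sin ((k + 1) x)` as an element of `L²(0, π)`; the indexing by
`k ≥ 0` is that of the enumeration `f 1, f 2, …` of a Fučík system. -/
noncomputable def sineLp (k : ℕ) : Lp 𝕜 2 (volume.restrict (Ioo 0 π)) :=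
  (memLp_sin_nat_mul 𝕜 (k + 1)).toLp

theorem inner_sineLp (i j : ℕ) :
    inner 𝕜 (sineLp 𝕜 i) (sineLp 𝕜 j) = if i = j then ((π / 2 : ℝ) : 𝕜) else 0 := by
  rw [sineLp, sineLp, inner_toLp_ofReal, ← integral_Ioc_eq_integral_Ioo,
    ← intervalIntegral.integral_of_le pi_pos.le, integral_sin_mul_sin_nat]
  split_ifs <;> simp only [RCLike.ofReal_zero]

theorem eq_zero_of_inner_sineLp_eq_zero {g : Lp 𝕜 2 (volume.restrict (Ioo 0 π))}
    (h : ∀ k, inner 𝕜 (sineLp 𝕜 k) g = 0) : g = 0 := by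
  have hg : Integrable g (volume.restrict (Ioo 0 π)) := (Lp.memLp g).integrable one_le_two
  rw [Lp.eq_zero_iff_ae_eq_zero]
  refine ae_eq_zero_of_integral_sin_smul_eq_zero hg fun n => ?_
  rcases n with _ | k
  · simp
  rw [← h k, L2.inner_def]
  refine integral_congr_ae ?_
  filter_upwards [(memLp_sin_nat_mul 𝕜 (k + 1)).coeFn_toLp] with x hx
  rw [sineLp, hx, RCLike.inner_apply, RCLike.conj_ofReal, RCLike.real_smul_eq_coe_mul, mul_comm]

theorem orthonormal_smul_sineLp :
    Orthonormal 𝕜 fun k => (((√(π / 2))⁻¹ : ℝ) : 𝕜) • sineLp 𝕜 k := by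
  rw [orthonormal_iff_ite]
  intro i j
  rw [inner_smul_left, inner_smul_right, inner_sineLp, RCLike.conj_ofReal]
  split_ifs
  · have hnorm : (√(π / 2))⁻¹ * ((√(π / 2))⁻¹ * (π / 2)) = 1 := by
      rw [← mul_assoc, ← mul_inv, Real.mul_self_sqrt (by positivity),
        inv_mul_cancel₀ (by positivity)]
    exact_mod_cast hnorm
  · rw [mul_zero, mul_zero]

theorem ofReal_sqrt_pi_div_two_ne_zero : ((√(π / 2) : ℝ) : 𝕜) ≠ 0 :=
  RCLike.ofReal_ne_zero.2 (by positivity)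

/-- The Hilbert basis `x ↦ √(2 / π) sin ((k + 1) x)` of `L²(0, π)`. -/
noncomputable def sineBasis : HilbertBasis ℕ 𝕜 (Lp 𝕜 2 (volume.restrict (Ioo 0 π))) :=
  HilbertBasis.mkOfOrthogonalEqBot (orthonormal_smul_sineLp 𝕜) <| by
    rw [Submodule.eq_bot_iff]
    refine fun g hg => eq_zero_of_inner_sineLp_eq_zero 𝕜 fun k => ?_
    have hk := (Submodule.mem_orthogonal _ _).1 hg _ (Submodule.subset_span ⟨k, rfl⟩)
    rw [inner_smul_left, RCLike.conj_ofReal, RCLike.ofReal_inv] at hk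
    exact (mul_eq_zero.1 hk).resolve_left (inv_ne_zero (ofReal_sqrt_pi_div_two_ne_zero 𝕜))

theorem sqrt_pi_div_two_smul_sineBasis (k : ℕ) :
    ((√(π / 2) : ℝ) : 𝕜) • sineBasis 𝕜 k = sineLp 𝕜 k := by
  rw [sineBasis, HilbertBasis.coe_mkOfOrthogonalEqBot, RCLike.ofReal_inv,
    smul_inv_smul₀ (ofReal_sqrt_pi_div_two_ne_zero 𝕜)]

end SineBasis

section Arches

/-- The frequency of the `i`-th arch of a piecewise sine alternating between the frequencies `ω`
and `τ`. For a Fučík eigenfunction these are `√α` and `√β`. -/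
def archFreq (ω τ : ℝ) (i : ℕ) : ℝ := if Even i then ω else τ

/-- The left end of the `i`-th arch of a piecewise sine starting at `0`: each arch is half a period
of its frequency. -/
noncomputable def archZero (ω τ : ℝ) (i : ℕ) : ℝ := ∑ j ∈ Finset.range i, π / archFreq ω τ j

/-- The function `u` consists of `n` consecutive sine arches of alternating sign and alternating
frequencies `ω` and `τ`, starting at `0`, whose slopes at the zeros are `p, -p, p, …`. Nothing is
said about `u` outside `[0, archZero ω τ n]`. -/
def HasArches (ω τ p : ℝ) (n : ℕ) (u : ℝ → ℝ) : Prop :=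
  ∀ i < n, ∀ x ∈ Icc (archZero ω τ i) (archZero ω τ (i + 1)),
    u x = (-1) ^ i * p / archFreq ω τ i * sin (archFreq ω τ i * (x - archZero ω τ i))

variable {ω τ p : ℝ} {n : ℕ} {u : ℝ → ℝ}

theorem archZero_zero : archZero ω τ 0 = 0 := Finset.sum_range_zero _

theorem archZero_succ (i : ℕ) : archZero ω τ (i + 1) = archZero ω τ i + π / archFreq ω τ i :=
  Finset.sum_range_succ _ _

theorem archFreq_pos (hω : 0 < ω) (hτ : 0 < τ) (i : ℕ) : 0 < archFreq ω τ i := by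
  unfold archFreq
  split_ifs <;> assumption

theorem min_le_archFreq (i : ℕ) : min ω τ ≤ archFreq ω τ i := by
  unfold archFreq
  split_ifs
  exacts [min_le_left _ _, min_le_right _ _]

theorem archZero_mono (hω : 0 < ω) (hτ : 0 < τ) : Monotone (archZero ω τ) :=
  monotone_nat_of_le_succ fun i => by
    rw [archZero_succ]
    linarith [div_pos pi_pos (archFreq_pos hω hτ i)]

theorem archZero_nonneg (hω : 0 < ω) (hτ : 0 < τ) (i : ℕ) : 0 ≤ archZero ω τ i :=
  archZero_zero.ge.trans (archZero_mono hω hτ (Nat.zero_le i))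

theorem HasArches.apply_midpoint (h : HasArches ω τ p n u) (hω : 0 < ω) (hτ : 0 < τ) {i : ℕ}
    (hi : i < n) :
    u (archZero ω τ i + π / archFreq ω τ i / 2) = (-1) ^ i * p / archFreq ω τ i := by
  have hw := archFreq_pos hω hτ i
  have hlen : 0 < π / archFreq ω τ i := div_pos pi_pos hw
  have hquarter : archFreq ω τ i * (π / archFreq ω τ i / 2) = π / 2 := by field_simp
  rw [h i hi _ ⟨by linarith, by rw [archZero_succ]; linarith⟩, add_sub_cancel_left, hquarter,
    sin_pi_div_two, mul_one]

theorem exists_mem_Icc_archZero (hω : 0 < ω) (hτ : 0 < τ) (hn : 0 < n) {x : ℝ}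
    (hx : x ∈ Icc 0 (archZero ω τ n)) :
    ∃ i < n, x ∈ Icc (archZero ω τ i) (archZero ω τ (i + 1)) := by
  rcases hx.1.eq_or_lt with rfl | hx0
  · exact ⟨0, hn, archZero_zero.le, archZero_nonneg hω hτ 1⟩
  · have hcover := Ioc_subset_biUnion_Ioc n (archZero ω τ) ⟨by rwa [archZero_zero], hx.2⟩
    simp only [mem_iUnion, Finset.mem_range] at hcover
    obtain ⟨i, hi, hxi⟩ := hcover
    exact ⟨i, hi, Ioc_subset_Icc_self hxi⟩

theorem HasArches.abs_le (h : HasArches ω τ p n u) (hω : 0 < ω) (hτ : 0 < τ) (hp : 0 ≤ p)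
    (hn : 0 < n) {x : ℝ} (hx : x ∈ Icc 0 (archZero ω τ n)) : |u x| ≤ p / min ω τ := by
  obtain ⟨i, hi, hxi⟩ := exists_mem_Icc_archZero hω hτ hn hx
  have hw := archFreq_pos hω hτ i
  rw [h i hi x hxi, abs_mul, abs_div, abs_mul, abs_neg_one_pow, one_mul, abs_of_nonneg hp,
    abs_of_pos hw]
  calc p / archFreq ω τ i * |sin (archFreq ω τ i * (x - archZero ω τ i))|
      ≤ p / archFreq ω τ i := mul_le_of_le_one_right (by positivity) (abs_sin_le_one _)
    _ ≤ p / min ω τ := div_le_div_of_nonneg_left hp (lt_min hω hτ) (min_le_archFreq i)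

end Arches

section FucikEquation

variable {α β : ℝ} {u : ℝ → ℝ}

/-- The vector field of the first-order system `(u, u')' = (u', -(α u⁺ - β u⁻))`. -/
def fucikField (α β : ℝ) (y : ℝ × ℝ) : ℝ × ℝ := (y.2, -(α * max y.1 0 - β * max (-y.1) 0))

/-- The phase curve `(u, u')` on `[0, π]`, with the one-sided derivatives at the end points. -/
noncomputable def phaseCurve (u : ℝ → ℝ) (x : ℝ) : ℝ × ℝ := (u x, derivWithin u (Icc 0 π) x)

/-- The phase curve of the sine of frequency `ω` vanishing at `a` with slope `q`. -/
noncomputable def sinePhaseCurve (q ω a x : ℝ) : ℝ × ℝ :=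
  (q / ω * sin (ω * (x - a)), q * cos (ω * (x - a)))

theorem exists_lipschitzWith_fucikField (α β : ℝ) : ∃ K, LipschitzWith K (fucikField α β) := by
  have hpos := (lipschitzWith_smul α).comp (LipschitzWith.id.max_const (0 : ℝ))
  have hneg := (lipschitzWith_smul β).comp ((LipschitzWith.id (α := ℝ)).neg.max_const 0)
  exact ⟨_, LipschitzWith.prod_snd.prodMk (((hpos.sub hneg).neg).comp LipschitzWith.prod_fst)⟩

theorem IsFucikSolution.derivWithin_derivWithin (h : IsFucikSolution α β u) :
    EqOn (derivWithin (derivWithin u (Icc 0 π)) (Icc 0 π))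
      (fun x => -(α * max (u x) 0 - β * max (-u x) 0)) (Icc 0 π) := by
  have huniq : UniqueDiffOn ℝ (Icc 0 π) := uniqueDiffOn_Icc pi_pos
  have hu : ContinuousOn u (Icc 0 π) := h.contDiffOn.continuousOn
  have hu'' : ContinuousOn (derivWithin (derivWithin u (Icc 0 π)) (Icc 0 π)) (Icc 0 π) :=
    (h.contDiffOn.derivWithin (m := 1) huniq (by norm_num)).continuousOn_derivWithin huniq
      (by norm_num)
  refine EqOn.of_subset_closure (s := Ioo 0 π) (fun x hx => ?_) hu'' (by fun_prop)
    Ioo_subset_Icc_self (by rw [closure_Ioo pi_pos.ne])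
  have hderiv : derivWithin u (Icc 0 π) =ᶠ[nhds x] deriv u := by
    filter_upwards [Ioo_mem_nhds hx.1 hx.2] with z hz
    exact derivWithin_of_mem_nhds (Icc_mem_nhds hz.1 hz.2)
  rw [derivWithin_of_mem_nhds (Icc_mem_nhds hx.1 hx.2), hderiv.deriv_eq, ← h.equation x hx, neg_neg]

theorem IsFucikSolution.hasDerivWithinAt_phaseCurve (h : IsFucikSolution α β u) {x : ℝ}
    (hx : x ∈ Icc 0 π) :
    HasDerivWithinAt (phaseCurve u) (fucikField α β (phaseCurve u x)) (Icc 0 π) x := by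
  have hu' : DifferentiableOn ℝ (derivWithin u (Icc 0 π)) (Icc 0 π) :=
    (h.contDiffOn.derivWithin (m := 1) (uniqueDiffOn_Icc pi_pos) (by norm_num)).differentiableOn
      (by norm_num)
  have hderiv := (hu' x hx).hasDerivWithinAt
  rw [h.derivWithin_derivWithin hx] at hderiv
  exact ((h.contDiffOn.differentiableOn (by norm_num) x hx).hasDerivWithinAt).prodMk hderiv

theorem hasDerivAt_sinePhaseCurve {q ω a : ℝ} (hω : ω ≠ 0) (x : ℝ) :
    HasDerivAt (sinePhaseCurve q ω a)
      (q * cos (ω * (x - a)), -(ω ^ 2 * (q / ω * sin (ω * (x - a))))) x := by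
  have hphase : HasDerivAt (fun x => ω * (x - a)) ω x := by
    simpa only [mul_one] using ((hasDerivAt_id' x).sub_const a).const_mul ω
  refine ((hphase.sin.const_mul (q / ω)).congr_deriv ?_).prodMk
    ((hphase.cos.const_mul q).congr_deriv ?_) <;> field_simp

theorem hasDerivAt_sinePhaseCurve_fucikField {q ω a x : ℝ} (hω : 0 < ω)
    (hq : ∀ s, 0 ≤ s → α * max (q * s) 0 - β * max (-(q * s)) 0 = ω ^ 2 * (q * s))
    (hx : x ∈ Icc a (a + π / ω)) :
    HasDerivAt (sinePhaseCurve q ω a) (fucikField α β (sinePhaseCurve q ω a x)) x := by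
  have hphase : ω * (x - a) ≤ π := by
    rw [← le_div_iff₀' hω]
    linarith [hx.2]
  have hs : 0 ≤ sin (ω * (x - a)) / ω :=
    div_nonneg (sin_nonneg_of_nonneg_of_le_pi (mul_nonneg hω.le (sub_nonneg.2 hx.1)) hphase) hω.le
  convert! hasDerivAt_sinePhaseCurve hω.ne' x using 1
  have hcomm : q / ω * sin (ω * (x - a)) = q * (sin (ω * (x - a)) / ω) := by ring
  simp only [fucikField, sinePhaseCurve, hcomm, hq _ hs]

theorem IsFucikSolution.eqOn_sinePhaseCurve (h : IsFucikSolution α β u) {q ω a : ℝ} (ha : 0 ≤ a)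
    (hω : 0 < ω) (hend : a + π / ω ≤ π)
    (hq : ∀ s, 0 ≤ s → α * max (q * s) 0 - β * max (-(q * s)) 0 = ω ^ 2 * (q * s))
    (hinit : phaseCurve u a = (0, q)) :
    EqOn (phaseCurve u) (sinePhaseCurve q ω a) (Icc a (a + π / ω)) := by
  obtain ⟨K, hK⟩ := exists_lipschitzWith_fucikField α β
  have hsub : Icc a (a + π / ω) ⊆ Icc 0 π := Icc_subset_Icc ha hend
  refine ODE_solution_unique (v := fun _ => fucikField α β) (fun _ => hK)
    (fun x hx => (h.hasDerivWithinAt_phaseCurve (hsub hx)).continuousWithinAt.mono hsub)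
    (fun x hx => ?_)
    (fun x _ => (hasDerivAt_sinePhaseCurve hω.ne' x).continuousAt.continuousWithinAt)
    (fun x hx => (hasDerivAt_sinePhaseCurve_fucikField hω hq
      (Ico_subset_Icc_self hx)).hasDerivWithinAt) ?_
  · refine (h.hasDerivWithinAt_phaseCurve (hsub (Ico_subset_Icc_self hx))).mono_of_mem_nhdsWithin ?_
    exact Filter.mem_of_superset (Icc_mem_nhdsGE (hx.2.trans_le hend))
      (Icc_subset_Icc_left (ha.trans hx.1))
  · rw [hinit, sinePhaseCurve, sub_self, mul_zero, sin_zero, cos_zero, mul_zero, mul_one]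

theorem sinePhaseCurve_add_pi_div {q ω a : ℝ} (hω : ω ≠ 0) :
    sinePhaseCurve q ω a (a + π / ω) = (0, -q) := by
  rw [sinePhaseCurve, add_sub_cancel_left, mul_div_cancel₀ _ hω, sin_pi, cos_pi, mul_zero,
    mul_neg_one]

theorem fucik_nonlinearity_of_neg_one_pow (hα : 0 ≤ α) (hβ : 0 ≤ β) {p : ℝ} (hp : 0 ≤ p) (i : ℕ)
    {s : ℝ} (hs : 0 ≤ s) :
    α * max ((-1) ^ i * p * s) 0 - β * max (-((-1) ^ i * p * s)) 0
      = archFreq (√α) (√β) i ^ 2 * ((-1) ^ i * p * s) := by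
  have hps : 0 ≤ p * s := mul_nonneg hp hs
  rw [mul_assoc]
  rcases i.even_or_odd with hi | hi
  · rw [archFreq, if_pos hi, hi.neg_one_pow, one_mul, max_eq_left hps, max_eq_right (by linarith),
      sq_sqrt hα, mul_zero, sub_zero]
  · rw [archFreq, if_neg (Nat.not_even_iff_odd.2 hi), hi.neg_one_pow, neg_one_mul, neg_neg,
      max_eq_left hps, max_eq_right (by linarith), sq_sqrt hβ]
    ring

theorem IsFucikSolution.phaseCurve_archZero (h : IsFucikSolution α β u) (hα : 0 < α) (hβ : 0 < β)
    (hp : 0 ≤ derivWithin u (Icc 0 π) 0) {i : ℕ} (hi : archZero (√α) (√β) i ≤ π) :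
    phaseCurve u (archZero (√α) (√β) i) = (0, (-1) ^ i * derivWithin u (Icc 0 π) 0) := by
  have hω := Real.sqrt_pos.2 hα
  have hτ := Real.sqrt_pos.2 hβ
  induction i with
  | zero => rw [phaseCurve, archZero_zero, h.left, pow_zero, one_mul]
  | succ i ih =>
    have hw := archFreq_pos hω hτ i
    have hinit := ih ((archZero_mono hω hτ i.le_succ).trans hi)
    rw [archZero_succ] at hi ⊢
    rw [h.eqOn_sinePhaseCurve (archZero_nonneg hω hτ i) hw hi
      (fun s => fucik_nonlinearity_of_neg_one_pow hα.le hβ.le hp i) hinit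
      (right_mem_Icc.2 (le_add_of_nonneg_right (by positivity))),
      sinePhaseCurve_add_pi_div hw.ne', pow_succ, mul_neg_one, neg_mul]

theorem IsFucikSolution.hasArches (h : IsFucikSolution α β u) (hα : 0 < α) (hβ : 0 < β)
    (hp : 0 ≤ derivWithin u (Icc 0 π) 0) {n : ℕ} (hn : archZero (√α) (√β) n ≤ π) :
    HasArches (√α) (√β) (derivWithin u (Icc 0 π) 0) n u := by
  have hω := Real.sqrt_pos.2 hα
  have hτ := Real.sqrt_pos.2 hβ
  intro i hi x hx
  have hend : archZero (√α) (√β) (i + 1) ≤ π := (archZero_mono hω hτ hi).trans hn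
  have hinit := h.phaseCurve_archZero hα hβ hp ((archZero_mono hω hτ i.le_succ).trans hend)
  rw [archZero_succ] at hend hx
  exact congrArg Prod.fst (h.eqOn_sinePhaseCurve (archZero_nonneg hω hτ i)
    (archFreq_pos hω hτ i) hend (fun s => fucik_nonlinearity_of_neg_one_pow hα.le hβ.le hp i)
    hinit hx)

theorem IsNormalizedFucikEigenfunction.derivWithin_zero
    (h : IsNormalizedFucikEigenfunction α β u) (hα : 0 < α) (hβ : 0 < β) {n : ℕ} (hn : 2 ≤ n)
    (hz : archZero (√α) (√β) n = π) : derivWithin u (Icc 0 π) 0 = min (√α) (√β) := by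
  have hω := Real.sqrt_pos.2 hα
  have hτ := Real.sqrt_pos.2 hβ
  have hp := h.slope_pos
  have harch := h.solution.hasArches hα hβ hp.le hz.le
  have hslope {i : ℕ} (hi : i < n) : derivWithin u (Icc 0 π) 0 ≤ archFreq (√α) (√β) i := by
    have hw := archFreq_pos hω hτ i
    have hlen : 0 < π / archFreq (√α) (√β) i := by positivity
    have hnext : archZero (√α) (√β) (i + 1) ≤ π := (archZero_mono hω hτ hi).trans hz.le
    rw [archZero_succ] at hnext
    have hle := h.norm_one.1 ⟨archZero (√α) (√β) i + π / archFreq (√α) (√β) i / 2,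
      ⟨add_nonneg (archZero_nonneg hω hτ i) (by positivity), by linarith⟩, rfl⟩
    simp only [harch.apply_midpoint hω hτ hi] at hle
    rwa [abs_div, abs_mul, abs_neg_one_pow, one_mul, abs_of_pos hp, abs_of_pos hw,
      div_le_one hw] at hle
  refine le_antisymm (le_min (hslope (i := 0) (by omega)) (hslope (i := 1) (by omega))) ?_
  rw [← one_le_div₀ (lt_min hω hτ)]
  refine h.norm_one.2 ?_
  rintro _ ⟨x, hx, rfl⟩
  exact harch.abs_le hω hτ hp.le (by omega) (hz.symm ▸ hx)

end FucikEquation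

section ArchSums

/-- The number of arches of even index among `n` consecutive arches; these are the positive ones
of an eigenfunction on the `n`-th Fučík curve. -/
def posArches (n : ℕ) : ℕ := (n + 1) / 2

/-- The number of arches of odd index among `n` consecutive arches; these are the negative ones
of an eigenfunction on the `n`-th Fučík curve. -/
def negArches (n : ℕ) : ℕ := n / 2

theorem posArches_two_mul (m : ℕ) : posArches (2 * m) = m := by
  unfold posArches
  omega

theorem negArches_two_mul (m : ℕ) : negArches (2 * m) = m := by
  unfold negArches
  omega

theorem posArches_two_mul_add_one (m : ℕ) : posArches (2 * m + 1) = m + 1 := by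
  unfold posArches
  omega

theorem negArches_two_mul_add_one (m : ℕ) : negArches (2 * m + 1) = m := by
  unfold negArches
  omega

theorem posArches_add_negArches (n : ℕ) : posArches n + negArches n = n := by
  unfold posArches negArches
  omega

theorem cast_posArches_add_negArches (n : ℕ) : (posArches n + negArches n : ℝ) = n := by
  exact_mod_cast posArches_add_negArches n

theorem negArches_le_posArches (n : ℕ) : negArches n ≤ posArches n := by
  unfold posArches negArches
  omega

theorem posArches_le_negArches_add_one (n : ℕ) : posArches n ≤ negArches n + 1 := by
  unfold posArches negArches
  omega

theorem posArches_mul_add_negArches_mul_of_mem_fucikCurve {n : ℕ} {q : ℝ × ℝ}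
    (h : q ∈ fucikCurve n) :
    posArches n * (π / √q.1) + negArches n * (π / √q.2) = π := by
  obtain ⟨-, -, hlen⟩ := h
  rcases n.even_or_odd' with ⟨m, rfl | rfl⟩
  · rw [if_pos (even_two_mul m)] at hlen
    push_cast at hlen
    rw [posArches_two_mul, negArches_two_mul]
    linear_combination hlen
  · rw [if_neg (Nat.not_even_iff_odd.2 (odd_two_mul_add_one m))] at hlen
    push_cast at hlen
    rw [posArches_two_mul_add_one, negArches_two_mul_add_one]
    push_cast
    linear_combination hlen

theorem sum_filter_even_range {M : Type*} [AddCommMonoid M] (g : ℕ → M) (n : ℕ) :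
    ∑ i ∈ Finset.range n with Even i, g i = ∑ j ∈ Finset.range (posArches n), g (2 * j) := by
  unfold posArches
  refine Finset.sum_nbij' (fun i => i / 2) (fun j => 2 * j) ?_ ?_ ?_ ?_ ?_
  · grind
  · grind
  · grind
  · grind
  · intro i hi
    rw [Nat.two_mul_div_two_of_even (Finset.mem_filter.1 hi).2]

variable {ω τ : ℝ}

theorem comp_archFreq (g : ℝ → ℝ) (i : ℕ) :
    g (archFreq ω τ i) = g τ + if Even i then g ω - g τ else 0 := by
  unfold archFreq
  split_ifs <;> ring

theorem sum_comp_archFreq (g : ℝ → ℝ) (n : ℕ) :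
    ∑ i ∈ Finset.range n, g (archFreq ω τ i) = posArches n * g ω + negArches n * g τ := by
  simp only [comp_archFreq g, Finset.sum_add_distrib, ← Finset.sum_filter]
  rw [sum_filter_even_range, Finset.sum_const, Finset.sum_const, Finset.card_range,
    Finset.card_range, nsmul_eq_mul, nsmul_eq_mul, ← cast_posArches_add_negArches n]
  ring

theorem archZero_eq (n : ℕ) :
    archZero ω τ n = posArches n * (π / ω) + negArches n * (π / τ) :=
  sum_comp_archFreq (fun w => π / w) n

theorem sum_neg_one_pow_mul_add_succ (s : ℕ → ℝ) (n : ℕ) :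
    ∑ i ∈ Finset.range n, (-1) ^ i * (s i + s (i + 1)) = s 0 - (-1) ^ n * s n := by
  have hstep (i : ℕ) :
      (-1) ^ i * (s i + s (i + 1)) = (-1) ^ i * s i - (-1) ^ (i + 1) * s (i + 1) := by ring
  simp only [hstep, Finset.sum_range_sub' (fun i => (-1) ^ i * s i), pow_zero, one_mul]

/- The contribution of the constant function `g τ` telescopes, so only the arches of even index
remain. -/
theorem sum_neg_one_pow_mul_comp_archFreq {s : ℕ → ℝ} {n : ℕ} (h0 : s 0 = 0) (hn : s n = 0)
    (g : ℝ → ℝ) :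
    ∑ i ∈ Finset.range n, (-1) ^ i * (s i + s (i + 1)) * g (archFreq ω τ i)
      = (∑ j ∈ Finset.range (posArches n), (s (2 * j) + s (2 * j + 1))) * (g ω - g τ) := by
  simp only [comp_archFreq g, mul_add, mul_ite, mul_zero, Finset.sum_add_distrib,
    ← Finset.sum_filter, ← Finset.sum_mul]
  simp only [← mul_add, ← Finset.sum_add_distrib, sum_neg_one_pow_mul_add_succ, h0, hn, mul_zero,
    sub_zero, zero_mul, zero_add, sum_filter_even_range, (even_two_mul _).neg_one_pow, one_mul]

/-- With `a` positive and `b` negative arches, `a - b ∈ {0, 1}`, of half-periods `π / ω` and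
`π / τ` filling `[0, π]`, and `η = π / τ - π / ω`, this is the sum of the values of
`sin ((a + b) x)` at both ends of all positive arches. -/
noncomputable def archSineSum (a b : ℕ) (η : ℝ) : ℝ :=
  ∑ j ∈ Finset.range a, (sin (j * (a - b) * η) + sin ((b - j * (a - b)) * η))

theorem archSineSum_neg (a b : ℕ) (η : ℝ) : archSineSum a b (-η) = -archSineSum a b η := by
  simp only [archSineSum, mul_neg, sin_neg, ← neg_add, Finset.sum_neg_distrib]

theorem sin_archZero_add_sin_archZero_succ {n : ℕ} (hπ : archZero ω τ n = π) (j : ℕ) :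
    sin (n * archZero ω τ (2 * j)) + sin (n * archZero ω τ (2 * j + 1))
      = sin (j * (posArches n - negArches n) * (π / τ - π / ω))
        + sin ((negArches n - j * (posArches n - negArches n)) * (π / τ - π / ω)) := by
  have hfreq : archFreq ω τ (2 * j) = ω := if_pos (even_two_mul j)
  rw [archZero_eq] at hπ
  rw [archZero_succ, archZero_eq, posArches_two_mul, negArches_two_mul, hfreq,
    ← cast_posArches_add_negArches n]
  congr 1
  · rw [← sin_add_nat_mul_two_pi (j * _ * _) j]
    congr 1
    linear_combination (2 * j : ℝ) * hπ
  · rw [← sin_pi_sub ((_ - _) * _), ← sin_add_nat_mul_two_pi (π - _) j]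
    congr 1
    linear_combination (2 * j + 1 : ℝ) * hπ

theorem mul_nat_sub_nonneg_and_le {a b j : ℕ} (hba : b ≤ a) (hab : a ≤ b + 1) (hj : j < a) :
    (0 : ℝ) ≤ j * (a - b) ∧ (j * (a - b) : ℝ) ≤ b := by
  obtain rfl | rfl : a = b ∨ a = b + 1 := by omega
  · simp
  · have hjb : (j : ℝ) ≤ b := by exact_mod_cast Nat.lt_succ_iff.1 hj
    simpa using hjb

theorem archSineSum_nonneg {a b : ℕ} (hba : b ≤ a) (hab : a ≤ b + 1) {η : ℝ} (hη : 0 ≤ η)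
    (hη' : b * η ≤ π) : 0 ≤ archSineSum a b η := by
  refine Finset.sum_nonneg fun j hj => ?_
  obtain ⟨h0, hle⟩ := mul_nat_sub_nonneg_and_le hba hab (Finset.mem_range.1 hj)
  have hsin {t : ℝ} (ht0 : 0 ≤ t) (htb : t ≤ b) : 0 ≤ sin (t * η) :=
    sin_nonneg_of_nonneg_of_le_pi (by positivity) (le_trans (by gcongr) hη')
  exact add_nonneg (hsin h0 hle) (hsin (sub_nonneg.2 hle) (sub_le_self _ h0))

theorem le_archSineSum {a b : ℕ} (hba : b ≤ a) (hab : a ≤ b + 1) {η : ℝ} (hη : 0 ≤ η) :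
    a * b * η * (1 - a * b * η ^ 2 / 6) ≤ archSineSum a b η := by
  have hterm : ∀ j ∈ Finset.range a, b * η * (1 - a * b * η ^ 2 / 6)
      ≤ sin (j * (a - b) * η) + sin ((b - j * (a - b)) * η) := fun j hj => by
    obtain ⟨h0, hle⟩ := mul_nat_sub_nonneg_and_le hba hab (Finset.mem_range.1 hj)
    set t : ℝ := j * (a - b)
    have hcubes : (t * η) ^ 3 + ((b - t) * η) ^ 3 ≤ (b * η) ^ 3 := by
      have hcross : 0 ≤ 3 * b * t * (b - t) * η ^ 3 :=
        mul_nonneg (mul_nonneg (by positivity) (sub_nonneg.2 hle)) (by positivity)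
      linarith
    have hcube : (b * η) ^ 3 ≤ b * η * (a * b * η ^ 2) := by
      calc (b * η) ^ 3 = b * η * (b * b * η ^ 2) := by ring
        _ ≤ b * η * (a * b * η ^ 2) := by gcongr
    have hsin := sin_ge_sub_cube (mul_nonneg h0 hη)
    have hsin' := sin_ge_sub_cube (mul_nonneg (sub_nonneg.2 hle) hη)
    linarith
  simpa only [archSineSum, Finset.sum_const, Finset.card_range, nsmul_eq_mul, mul_assoc]
    using Finset.sum_le_sum hterm

end ArchSums

section Integrals

variable {ω τ p : ℝ} {n : ℕ} {u : ℝ → ℝ}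

theorem HasArches.integral_comp_eq_sum (h : HasArches ω τ p n u) (hω : 0 < ω) (hτ : 0 < τ)
    {Φ : ℝ → ℝ → ℝ} (hΦ : Continuous (Function.uncurry Φ)) :
    ∫ x in 0..archZero ω τ n, Φ x (u x)
      = ∑ i ∈ Finset.range n, ∫ x in archZero ω τ i..archZero ω τ i + π / archFreq ω τ i,
          Φ x ((-1) ^ i * p / archFreq ω τ i * sin (archFreq ω τ i * (x - archZero ω τ i))) := by
  have harch {i : ℕ} (hi : i < n) : EqOn
      (fun x => Φ x ((-1) ^ i * p / archFreq ω τ i * sin (archFreq ω τ i * (x - archZero ω τ i))))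
      (fun x => Φ x (u x)) (uIcc (archZero ω τ i) (archZero ω τ (i + 1))) := fun x hx => by
    rw [uIcc_of_le (archZero_mono hω hτ i.le_succ)] at hx
    simp only [h i hi x hx]
  rw [← archZero_zero (ω := ω) (τ := τ), ← intervalIntegral.sum_integral_adjacent_intervals
    (a := archZero ω τ) fun i hi => ?_]
  · refine Finset.sum_congr rfl fun i hi => ?_
    rw [← archZero_succ, intervalIntegral.integral_congr (harch (Finset.mem_range.1 hi))]
  · refine IntervalIntegrable.congr ((harch hi).mono uIoc_subset_uIcc)
      (Continuous.intervalIntegrable ?_ _ _)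
    exact hΦ.comp (continuous_id.prodMk (by fun_prop))

theorem integral_sq_sine_arch (hω : ω ≠ 0) (a q : ℝ) :
    ∫ x in a..a + π / ω, (q / ω * sin (ω * (x - a))) ^ 2 = π / 2 * (q ^ 2 / ω ^ 3) := by
  simp_rw [mul_pow]
  rw [intervalIntegral.integral_const_mul,
    intervalIntegral.integral_comp_sub_right (fun y => sin (ω * y) ^ 2),
    intervalIntegral.integral_comp_mul_left (fun y => sin y ^ 2) hω, integral_sin_sq,
    sub_self, mul_zero, add_sub_cancel_left, mul_div_cancel₀ _ hω, sin_pi, sin_zero, smul_eq_mul]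
  field_simp
  ring

theorem hasDerivAt_primitive_sin_mul_sin {N : ℝ} (hN : ω ^ 2 ≠ N ^ 2) (a x : ℝ) :
    HasDerivAt (fun x => (N * sin (ω * (x - a)) * cos (N * x) - ω * cos (ω * (x - a)) * sin (N * x))
      / (ω ^ 2 - N ^ 2)) (sin (ω * (x - a)) * sin (N * x)) x := by
  have hne : ω ^ 2 - N ^ 2 ≠ 0 := sub_ne_zero.2 hN
  have hshift : HasDerivAt (fun x => ω * (x - a)) ω x := by
    simpa only [mul_one] using ((hasDerivAt_id' x).sub_const a).const_mul ω
  have hlin : HasDerivAt (fun x => N * x) N x := by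
    simpa only [mul_one] using (hasDerivAt_id' x).const_mul N
  refine ((((hshift.sin.const_mul N).mul hlin.cos).sub
    ((hshift.cos.const_mul ω).mul hlin.sin)).div_const (ω ^ 2 - N ^ 2)).congr_deriv ?_
  field_simp
  ring

theorem integral_sine_arch_mul_sin {N : ℝ} (hω : ω ≠ 0) (hN : ω ^ 2 ≠ N ^ 2) (a q : ℝ) :
    ∫ x in a..a + π / ω, q / ω * sin (ω * (x - a)) * sin (N * x)
      = q * (sin (N * a) + sin (N * (a + π / ω))) * (ω ^ 2 - N ^ 2)⁻¹ := by
  simp only [mul_assoc (q / ω)]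
  rw [intervalIntegral.integral_const_mul, intervalIntegral.integral_eq_sub_of_hasDerivAt
    (fun x _ => hasDerivAt_primitive_sin_mul_sin hN a x)
    (Continuous.intervalIntegrable (by fun_prop) _ _)]
  simp only [add_sub_cancel_left, mul_div_cancel₀ _ hω, sin_pi, cos_pi, sub_self, mul_zero,
    sin_zero, cos_zero]
  field_simp
  ring

theorem HasArches.integral_sq (h : HasArches ω τ p n u) (hω : 0 < ω) (hτ : 0 < τ) :
    ∫ x in 0..archZero ω τ n, u x ^ 2
      = p ^ 2 * (π / 2 * (posArches n / ω ^ 3 + negArches n / τ ^ 3)) := by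
  have hsum := sum_comp_archFreq (ω := ω) (τ := τ) (fun w => π / 2 * (p ^ 2 / w ^ 3)) n
  have harch (i : ℕ) : ∫ x in archZero ω τ i..archZero ω τ i + π / archFreq ω τ i,
      ((-1) ^ i * p / archFreq ω τ i * sin (archFreq ω τ i * (x - archZero ω τ i))) ^ 2
        = π / 2 * (p ^ 2 / archFreq ω τ i ^ 3) := by
    rw [integral_sq_sine_arch (archFreq_pos hω hτ i).ne', mul_pow, ← pow_mul, mul_comm i 2,
      (even_two_mul i).neg_one_pow, one_mul]
  rw [h.integral_comp_eq_sum hω hτ (Φ := fun _ y => y ^ 2) (by fun_prop)]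
  simp only [harch, hsum]
  ring

theorem HasArches.integral_mul_sin (h : HasArches ω τ p n u) (hω : 0 < ω) (hτ : 0 < τ)
    (hπ : archZero ω τ n = π) (hωn : ω ≠ n) (hτn : τ ≠ n) :
    ∫ x in 0..π, u x * sin (n * x)
      = p * archSineSum (posArches n) (negArches n) (π / τ - π / ω)
        * ((ω ^ 2 - n ^ 2)⁻¹ - (τ ^ 2 - n ^ 2)⁻¹) := by
  have hres (i : ℕ) : archFreq ω τ i ^ 2 ≠ (n : ℝ) ^ 2 := by
    rw [Ne, sq_eq_sq₀ (archFreq_pos hω hτ i).le n.cast_nonneg, archFreq]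
    split_ifs <;> assumption
  have hend : sin (n * archZero ω τ n) = 0 := by rw [hπ, sin_nat_mul_pi]
  have hstart : sin (n * archZero ω τ 0) = 0 := by rw [archZero_zero, mul_zero, sin_zero]
  have hsum := sum_neg_one_pow_mul_comp_archFreq (ω := ω) (τ := τ)
    (s := fun i => sin (n * archZero ω τ i)) hstart hend fun w => (w ^ 2 - n ^ 2)⁻¹
  simp only [sin_archZero_add_sin_archZero_succ hπ] at hsum
  conv_lhs => rw [← hπ]
  rw [h.integral_comp_eq_sum hω hτ (Φ := fun x y => y * sin (n * x)) (by fun_prop), mul_assoc,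
    archSineSum, ← hsum, Finset.mul_sum]
  refine Finset.sum_congr rfl fun i _ => ?_
  rw [integral_sine_arch_mul_sin (archFreq_pos hω hτ i).ne' (hres i), ← archZero_succ]
  ring

end Integrals

section DistanceToSine

variable {ω τ : ℝ} {n : ℕ} {u : ℝ → ℝ}

theorem HasArches.eqOn_sin_nat_mul (h : HasArches n n n n u) (hn : 0 < n) :
    EqOn u (fun x => sin (n * x)) (Icc 0 π) := fun x hx => by
  have hn0 : (0 : ℝ) < n := by exact_mod_cast hn
  have hfreq (i : ℕ) : archFreq n n i = n := ite_self _
  have hzero (i : ℕ) : archZero n n i = i * (π / n) := by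
    simp only [archZero, hfreq, Finset.sum_const, Finset.card_range, nsmul_eq_mul]
  have hlast : archZero n n n = π := by rw [hzero, mul_div_cancel₀ _ hn0.ne']
  rw [← hlast] at hx
  obtain ⟨i, hi, hxi⟩ := exists_mem_Icc_archZero hn0 hn0 hn hx
  have hshift : n * (x - i * (π / n)) = n * x - i * π := by field_simp
  rw [h i hi x hxi, hfreq, hzero, hshift, sin_sub_nat_mul_pi, mul_div_cancel_right₀ _ hn0.ne',
    ← mul_assoc, ← mul_pow, neg_one_mul, neg_neg, one_pow, one_mul]

theorem integral_sin_nat_mul_sq (hn : 0 < n) : ∫ x in 0..π, sin (n * x) ^ 2 = π / 2 := by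
  obtain ⟨k, rfl⟩ := Nat.exists_eq_succ_of_ne_zero hn.ne'
  simpa only [← sq, if_true] using integral_sin_mul_sin_nat k k

/-- The value of `∫ (u - sin (n ·))²` over `[0, π]` for a function `u` made of `n` arches of
frequencies `ω` and `τ` filling `[0, π]` and of maximal amplitude `1`. The formula is meant for
`ω ≠ n ≠ τ`; in the resonant case it contains the junk value `0⁻¹ = 0`. -/
noncomputable def archDistSq (ω τ : ℝ) (n : ℕ) : ℝ :=
  min ω τ ^ 2 * (π / 2 * (posArches n / ω ^ 3 + negArches n / τ ^ 3)) + π / 2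
    - 2 * min ω τ * archSineSum (posArches n) (negArches n) (π / τ - π / ω)
      * ((ω ^ 2 - n ^ 2)⁻¹ - (τ ^ 2 - n ^ 2)⁻¹)

theorem HasArches.integral_sub_sin_sq (h : HasArches ω τ (min ω τ) n u) (hω : 0 < ω) (hτ : 0 < τ)
    (hn : 0 < n) (hu : ContinuousOn u (Icc 0 π)) (hπ : archZero ω τ n = π) (hωn : ω ≠ n)
    (hτn : τ ≠ n) : ∫ x in 0..π, (u x - sin (n * x)) ^ 2 = archDistSq ω τ n := by
  have hsq := h.integral_sq hω hτ
  rw [hπ] at hsq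
  have hu' : ContinuousOn u (uIcc 0 π) := by rwa [uIcc_of_le pi_pos.le]
  have hexpand (x : ℝ) : (u x - sin (n * x)) ^ 2
      = u x ^ 2 + sin (n * x) ^ 2 - 2 * (u x * sin (n * x)) := by ring
  simp only [hexpand]
  rw [intervalIntegral.integral_sub (ContinuousOn.intervalIntegrable (by fun_prop))
      (ContinuousOn.intervalIntegrable (by fun_prop)),
    intervalIntegral.integral_add (ContinuousOn.intervalIntegrable (by fun_prop))
      (ContinuousOn.intervalIntegrable (by fun_prop)),
    intervalIntegral.integral_const_mul, hsq, integral_sin_nat_mul_sq hn,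
    h.integral_mul_sin hω hτ hπ hωn hτn, archDistSq]
  ring

end DistanceToSine

section DetuningEstimate

/- `a` short arches of frequency `ω = (a + b) / (1 - δ)` and `b` long arches of frequency `τ` fill
`[0, π]` exactly when `τ = (a + b) / (1 + κ * δ)` with `κ = a / b`; everything below is a function
of the detuning `δ` and the ratio `κ`. -/
variable {b κ δ : ℝ}

theorem energy_eq_of_detuning (hb : 0 < b) (hκ : 0 < κ) (hδ : 0 ≤ δ) (hδ1 : δ < 1) :
    ((κ * b + b) / (1 + κ * δ)) ^ 2 * (π / 2 * (κ * b / ((κ * b + b) / (1 - δ)) ^ 3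
        + b / ((κ * b + b) / (1 + κ * δ)) ^ 3))
      = π * (1 + 3 * κ * δ ^ 2 + κ * (κ - 1) * δ ^ 3) / (2 * (1 + κ * δ) ^ 2) := by
  have := sub_pos.2 hδ1
  have hN : κ * b + b = (κ + 1) * b := by ring
  rw [hN]
  field_simp
  ring

theorem half_add_three_quarters_mul_le_sq_div {t : ℝ} (ht : -2 < t) :
    1 / 2 + 3 / 4 * t ≤ (1 + t) ^ 2 / (2 + t) := by
  rw [le_div_iff₀ (by linarith)]
  linarith [sq_nonneg t]

theorem inv_le_resonance_of_detuning (hb : 0 < b) (hκ : 0 < κ) (hδ : 0 < δ) (hδ1 : δ < 1) :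
    (2 * (κ * b) * (κ * b + b) * δ)⁻¹
      ≤ (((κ * b + b) / (1 - δ)) ^ 2 - (κ * b + b) ^ 2)⁻¹
        - (((κ * b + b) / (1 + κ * δ)) ^ 2 - (κ * b + b) ^ 2)⁻¹ := by
  have hδ' : 0 < 1 - δ := sub_pos.2 hδ1
  have hδ2 : 0 < 2 - δ := by linarith
  have hshort := half_add_three_quarters_mul_le_sq_div (t := -δ) (by linarith)
  have hlong := half_add_three_quarters_mul_le_sq_div (t := κ * δ)
    (by linarith [mul_pos hκ hδ])
  set N := κ * b + b with hN
  have hN0 : 0 < N := by positivity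
  calc (2 * (κ * b) * N * δ)⁻¹
      = (N ^ 2 * δ)⁻¹ * ((1 / 2 + 3 / 4 * -δ) + κ⁻¹ * (1 / 2 + 3 / 4 * (κ * δ))) := by
        rw [hN]; field_simp; ring
    _ ≤ (N ^ 2 * δ)⁻¹ * ((1 + -δ) ^ 2 / (2 + -δ) + κ⁻¹ * ((1 + κ * δ) ^ 2 / (2 + κ * δ))) := by
        gcongr
    _ = ((N / (1 - δ)) ^ 2 - N ^ 2)⁻¹ - ((N / (1 + κ * δ)) ^ 2 - N ^ 2)⁻¹ := by
        have hres : (N / (1 - δ)) ^ 2 - N ^ 2 = N ^ 2 * (δ * (2 - δ)) / (1 - δ) ^ 2 := by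
          field_simp; ring
        have hres' : (N / (1 + κ * δ)) ^ 2 - N ^ 2
            = -(N ^ 2 * (κ * δ * (2 + κ * δ)) / (1 + κ * δ) ^ 2) := by
          field_simp; ring
        rw [hres, hres', inv_neg, inv_div, inv_div, ← sub_eq_add_neg, ← sub_eq_add_neg]
        field_simp
        ring

theorem detuned_distance_le (hκ : 0 < κ) (hδ : 0 < δ) :
    π * (1 + 3 * κ * δ ^ 2 + κ * (κ - 1) * δ ^ 3) / (2 * (1 + κ * δ) ^ 2) + π / 2
        - π * (1 - κ * (π * δ) ^ 2 / 6) / (1 + κ * δ)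
      ≤ π * κ * ((κ + 3) / 2 + π ^ 2 / 6) * δ ^ 2 := by
  have hcollect : π * (1 + 3 * κ * δ ^ 2 + κ * (κ - 1) * δ ^ 3) / (2 * (1 + κ * δ) ^ 2) + π / 2
        - π * (1 - κ * (π * δ) ^ 2 / 6) / (1 + κ * δ)
      = π * κ * (((κ + 3 + (κ - 1) * δ) / 2 + π ^ 2 / 6 * (1 + κ * δ)) / (1 + κ * δ) ^ 2)
        * δ ^ 2 := by
    field_simp
    ring
  rw [hcollect]
  gcongr
  rw [div_le_iff₀ (by positivity), add_mul]
  have hκδ : 0 < κ * δ := mul_pos hκ hδ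
  gcongr
  · nlinarith [mul_pos hκ hκδ, sq_nonneg (κ * δ), mul_pos hκ (mul_pos hκδ hκδ)]
  · exact le_self_pow₀ (by linarith) two_ne_zero

end DetuningEstimate

section FucikWeights

/-- The upper bound for `∫ (u - sin (n ·))²` over `[0, π]`, where `u` is a normalized
eigenfunction on the `n`-th Fučík curve, `κ` is the number of its short arches divided by the
number of its long ones, and `r` is the frequency of the short arches divided by `n`. -/
noncomputable def archBound (κ r : ℝ) : ℝ := π * κ * ((κ + 3) / 2 + π ^ 2 / 6) * (r - 1) ^ 2

theorem mul_sub_eq_mul_sub_of_half_periods {a b ω τ : ℝ} (hω : ω ≠ 0) (hτ : τ ≠ 0)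
    (hlen : a * (π / ω) + b * (π / τ) = π) : a * τ * (ω - (a + b)) = b * ω * (a + b - τ) := by
  field_simp at hlen
  linear_combination -(a + b) * hlen

theorem freq_trichotomy {a b ω τ : ℝ} (ha : 0 < a) (hb : 0 < b) (hω : 0 < ω) (hτ : 0 < τ)
    (hlen : a * (π / ω) + b * (π / τ) = π) :
    ω = a + b ∧ τ = a + b ∨ τ < a + b ∧ a + b < ω ∨ ω < a + b ∧ a + b < τ := by
  have hbalance := mul_sub_eq_mul_sub_of_half_periods hω.ne' hτ.ne' hlen
  have haτ := mul_pos ha hτ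
  have hbω := mul_pos hb hω
  rcases lt_trichotomy ω (a + b) with h | h | h
  · exact .inr (.inr ⟨h, by nlinarith⟩)
  · exact .inl ⟨h, by nlinarith⟩
  · exact .inr (.inl ⟨by nlinarith, h⟩)

theorem distance_sq_le_archBound {a b ω τ T : ℝ} (ha : 0 < a) (hb : 0 < b) (hτ : 0 < τ)
    (hω : a + b < ω) (hlen : a * (π / ω) + b * (π / τ) = π) (hT0 : 0 ≤ T)
    (hT : a * b * (π / τ - π / ω) * (1 - a * b * (π / τ - π / ω) ^ 2 / 6) ≤ T) :
    τ ^ 2 * (π / 2 * (a / ω ^ 3 + b / τ ^ 3)) + π / 2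
        - 2 * τ * T * ((ω ^ 2 - (a + b) ^ 2)⁻¹ - (τ ^ 2 - (a + b) ^ 2)⁻¹)
      ≤ archBound (a / b) (ω / (a + b)) := by
  obtain ⟨κ, hκ, rfl⟩ : ∃ κ, 0 < κ ∧ a = κ * b :=
    ⟨a / b, div_pos ha hb, (div_mul_cancel₀ a hb.ne').symm⟩
  have hN : 0 < κ * b + b := by positivity
  have hω0 : 0 < ω := hN.trans hω
  obtain ⟨δ, hδ, hδ1, rfl⟩ : ∃ δ, 0 < δ ∧ δ < 1 ∧ ω = (κ * b + b) / (1 - δ) :=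
    ⟨1 - (κ * b + b) / ω, sub_pos.2 ((div_lt_one hω0).2 hω), sub_lt_self _ (by positivity), by
      rw [sub_sub_cancel, div_div_cancel₀ hN.ne']⟩
  have hδ' : 0 < 1 - δ := sub_pos.2 hδ1
  obtain rfl : τ = (κ * b + b) / (1 + κ * δ) := by
    field_simp at hlen ⊢
    linear_combination -hlen
  have hη : π / ((κ * b + b) / (1 + κ * δ)) - π / ((κ * b + b) / (1 - δ)) = π * δ / b := by
    field_simp
    ring
  rw [hη] at hT
  have hcross : π * (1 - κ * (π * δ) ^ 2 / 6) / (1 + κ * δ)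
      ≤ 2 * ((κ * b + b) / (1 + κ * δ)) * T * ((((κ * b + b) / (1 - δ)) ^ 2 - (κ * b + b) ^ 2)⁻¹
        - (((κ * b + b) / (1 + κ * δ)) ^ 2 - (κ * b + b) ^ 2)⁻¹) := by
    calc π * (1 - κ * (π * δ) ^ 2 / 6) / (1 + κ * δ)
        = 2 * ((κ * b + b) / (1 + κ * δ))
            * (κ * b * b * (π * δ / b) * (1 - κ * b * b * (π * δ / b) ^ 2 / 6))
            * (2 * (κ * b) * (κ * b + b) * δ)⁻¹ := by field_simp
      _ ≤ _ := by
        gcongr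
        exact inv_le_resonance_of_detuning hb hκ hδ hδ1
  have hratio : δ ≤ (κ * b + b) / (1 - δ) / (κ * b + b) - 1 := by
    rw [div_right_comm, div_self hN.ne', le_sub_iff_add_le, le_div_iff₀ hδ']
    linarith [sq_nonneg δ]
  rw [energy_eq_of_detuning hb hκ hδ.le hδ1, archBound, mul_div_cancel_right₀ κ hb.ne']
  calc _ ≤ _ := sub_le_sub_left hcross _
    _ ≤ π * κ * ((κ + 3) / 2 + π ^ 2 / 6) * δ ^ 2 := detuned_distance_le hκ hδ
    _ ≤ _ := by gcongr

theorem negArches_pos {n : ℕ} (hn : 2 ≤ n) : 0 < negArches n := by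
  unfold negArches
  omega

theorem archDistSq_le_archBound_of_gt {n : ℕ} (hn : 2 ≤ n) {ω τ : ℝ} (hτ : 0 < τ) (hτn : τ < n)
    (hωn : n < ω) (hlen : posArches n * (π / ω) + negArches n * (π / τ) = π) :
    archDistSq ω τ n ≤ archBound (posArches n / negArches n) (ω / n) := by
  have hba := negArches_le_posArches n
  have hab := posArches_le_negArches_add_one n
  have hb : (0 : ℝ) < negArches n := Nat.cast_pos.2 (negArches_pos hn)
  have ha : (0 : ℝ) < posArches n := hb.trans_le (Nat.cast_le.2 hba)
  have hω : 0 < ω := hτ.trans (hτn.trans hωn)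
  have hη : 0 ≤ π / τ - π / ω := sub_nonneg.2 (by gcongr; exact (hτn.trans hωn).le)
  have hηπ : negArches n * (π / τ - π / ω) ≤ π := by
    have : 0 < π / ω := by positivity
    nlinarith
  rw [← cast_posArches_add_negArches n] at hωn
  have hle := distance_sq_le_archBound ha hb hτ hωn hlen (archSineSum_nonneg hba hab hη hηπ)
    (le_archSineSum hba hab hη)
  rw [cast_posArches_add_negArches n] at hle hωn
  rwa [archDistSq, min_eq_right (hτn.trans hωn).le]

theorem archDistSq_le_archBound_of_lt {n : ℕ} (hn : 2 ≤ n) {ω τ : ℝ} (hω : 0 < ω) (hωn : ω < n)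
    (hτn : n < τ) (hlen : posArches n * (π / ω) + negArches n * (π / τ) = π) :
    archDistSq ω τ n ≤ archBound (negArches n / posArches n) (τ / n) := by
  have hba := negArches_le_posArches n
  have hab := posArches_le_negArches_add_one n
  have hb : (0 : ℝ) < negArches n := Nat.cast_pos.2 (negArches_pos hn)
  have hba' : (negArches n : ℝ) ≤ posArches n := Nat.cast_le.2 hba
  have ha : (0 : ℝ) < posArches n := hb.trans_le hba'
  have hτ : 0 < τ := hω.trans (hωn.trans hτn)
  have hη : 0 ≤ π / ω - π / τ := sub_nonneg.2 (by gcongr; exact (hωn.trans hτn).le)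
  have hηπ : negArches n * (π / ω - π / τ) ≤ π := by
    have : 0 < π / τ := by positivity
    nlinarith
  have hT := le_archSineSum hba hab hη
  rw [mul_comm (posArches n : ℝ)] at hT
  rw [← cast_posArches_add_negArches n, add_comm] at hτn
  have hle := distance_sq_le_archBound hb ha hω hτn (by rwa [add_comm])
    (archSineSum_nonneg hba hab hη hηπ) hT
  rw [add_comm (negArches n : ℝ), cast_posArches_add_negArches n] at hle hτn
  rw [archDistSq, min_eq_left (hωn.trans hτn).le, ← neg_sub (π / ω), archSineSum_neg]
  linarith

theorem pi_sq_le_ten : π ^ 2 ≤ 10 := by nlinarith [pi_lt_d2, pi_pos]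

theorem short_arch_coefficient_le_of_odd_of_le {m : ℝ} (hm : 0 < m) :
    (m + 1) / m * (((m + 1) / m + 3) / 2 + π ^ 2 / 6)
      ≤ 4 * ((2 * m + 1) ^ 2 * ((2 * m + 1) ^ 2 + 1) / (2 * m) ^ 4) := by
  calc (m + 1) / m * (((m + 1) / m + 3) / 2 + π ^ 2 / 6)
      ≤ (m + 1) / m * (((m + 1) / m + 3) / 2 + 10 / 6) := by gcongr; exact pi_sq_le_ten
    _ = 4 * ((2 * m + 1) ^ 2 * ((2 * m + 1) ^ 2 + 1) / (2 * m) ^ 4)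
        - (2 * m ^ 4 + 23 * m ^ 3 + 39 * m ^ 2 + 18 * m + 3) / (6 * m ^ 4) := by
      field_simp
      ring
    _ ≤ _ := sub_le_self _ (by positivity)

theorem short_arch_coefficient_le_of_odd_of_lt {m : ℝ} (hm : 1 ≤ m) :
    m / (m + 1) * ((m / (m + 1) + 3) / 2 + π ^ 2 / 6)
      ≤ 5 * ((2 * m + 1) ^ 2 * ((2 * m + 1) ^ 2 + 1) / (2 * (m + 1)) ^ 4) := by
  obtain ⟨k, hk, rfl⟩ : ∃ k, 0 ≤ k ∧ m = k + 1 := ⟨m - 1, sub_nonneg.2 hm, by ring⟩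
  calc (k + 1) / (k + 1 + 1) * (((k + 1) / (k + 1 + 1) + 3) / 2 + π ^ 2 / 6)
      ≤ (k + 1) / (k + 1 + 1) * (((k + 1) / (k + 1 + 1) + 3) / 2 + 10 / 6) := by
        gcongr; exact pi_sq_le_ten
    _ = 5 * ((2 * (k + 1) + 1) ^ 2 * ((2 * (k + 1) + 1) ^ 2 + 1) / (2 * (k + 1 + 1)) ^ 4)
        - (32 * k ^ 4 + 116 * k ^ 3 + 126 * k ^ 2 + 46 * k + 19) / (24 * (k + 1 + 1) ^ 4) := by
      field_simp
      ring
    _ ≤ _ := sub_le_self _ (by positivity)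

theorem archBound_one_le (r : ℝ) : archBound 1 r ≤ 4 * (3 + π ^ 2) * π / 9 * (r - 1) ^ 2 := by
  unfold archBound
  gcongr ?_ * _
  nlinarith [pi_gt_three]

theorem archBound_le_fucikWeight_of_le {n : ℕ} (hn : 2 ≤ n) {x y : ℝ} (hyx : y ≤ x) :
    archBound (posArches n / negArches n) (√x / n) ≤ fucikWeight n x y := by
  unfold fucikWeight
  rcases n.even_or_odd' with ⟨m, rfl | rfl⟩
  · have hm : (m : ℝ) ≠ 0 := Nat.cast_ne_zero.2 (by omega)
    rw [if_pos (even_two_mul m), posArches_two_mul, negArches_two_mul, div_self hm,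
      max_eq_left (sqrt_le_sqrt hyx)]
    exact archBound_one_le _
  · have hm : (0 : ℝ) < m := by exact_mod_cast (by omega : 0 < m)
    rw [if_neg (Nat.not_even_iff_odd.2 (odd_two_mul_add_one m)), if_pos hyx,
      posArches_two_mul_add_one, negArches_two_mul_add_one, archBound, mul_assoc π, mul_comm 4 π,
      mul_assoc π 4]
    push_cast
    rw [add_sub_cancel_right]
    gcongr π * ?_ * _
    exact short_arch_coefficient_le_of_odd_of_le hm

theorem archBound_le_fucikWeight_of_lt {n : ℕ} (hn : 2 ≤ n) {x y : ℝ} (hxy : x < y) :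
    archBound (negArches n / posArches n) (√y / n) ≤ fucikWeight n x y := by
  unfold fucikWeight
  rcases n.even_or_odd' with ⟨m, rfl | rfl⟩
  · have hm : (m : ℝ) ≠ 0 := Nat.cast_ne_zero.2 (by omega)
    rw [if_pos (even_two_mul m), posArches_two_mul, negArches_two_mul, div_self hm,
      max_eq_right (sqrt_le_sqrt hxy.le)]
    exact archBound_one_le _
  · have hm : (1 : ℝ) ≤ m := by exact_mod_cast (by omega : 1 ≤ m)
    have hsucc : 2 * (m : ℝ) + 1 + 1 = 2 * (m + 1) := by ring
    rw [if_neg (Nat.not_even_iff_odd.2 (odd_two_mul_add_one m)), if_neg hxy.not_ge,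
      posArches_two_mul_add_one, negArches_two_mul_add_one, archBound, mul_assoc π, mul_comm 5 π,
      mul_assoc π 5]
    push_cast
    rw [hsucc]
    gcongr π * ?_ * _
    exact short_arch_coefficient_le_of_odd_of_lt hm

theorem fucikWeight_nonneg (n : ℕ) (x y : ℝ) : 0 ≤ fucikWeight n x y := by
  unfold fucikWeight
  split_ifs <;> positivity

theorem IsNormalizedFucikEigenfunction.hasArches {α β : ℝ} {u : ℝ → ℝ}
    (h : IsNormalizedFucikEigenfunction α β u) (hα : 0 < α) (hβ : 0 < β) {n : ℕ} (hn : 2 ≤ n)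
    (hz : archZero (√α) (√β) n = π) : HasArches (√α) (√β) (min (√α) (√β)) n u := by
  rw [← h.derivWithin_zero hα hβ hn hz]
  exact h.solution.hasArches hα hβ h.slope_pos.le hz.le

theorem IsNormalizedFucikEigenfunction.integral_sub_sin_sq_le_fucikWeight {α β : ℝ} {u : ℝ → ℝ}
    (h : IsNormalizedFucikEigenfunction α β u) {n : ℕ} (hn : 2 ≤ n) (hq : (α, β) ∈ fucikCurve n) :
    ∫ x in 0..π, (u x - sin (n * x)) ^ 2 ≤ fucikWeight n α β := by
  have hω : 0 < √α := sqrt_pos.2 hq.1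
  have hτ : 0 < √β := sqrt_pos.2 hq.2.1
  have hn0 : 0 < n := by omega
  have hlen := posArches_mul_add_negArches_mul_of_mem_fucikCurve hq
  have hz : archZero (√α) (√β) n = π := (archZero_eq n).trans hlen
  have harches := h.hasArches hq.1 hq.2.1 hn hz
  have hdist := harches.integral_sub_sin_sq hω hτ hn0 h.solution.contDiffOn.continuousOn hz
  have hb := negArches_pos hn
  have ha := hb.trans_le (negArches_le_posArches n)
  have hcases := freq_trichotomy (Nat.cast_pos.2 ha) (Nat.cast_pos.2 hb) hω hτ hlen
  rw [cast_posArches_add_negArches] at hcases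
  rcases hcases with ⟨hωn, hτn⟩ | ⟨hτn, hωn⟩ | ⟨hωn, hτn⟩
  · rw [hωn, hτn, min_self] at harches
    rw [intervalIntegral.integral_congr (g := fun _ => 0) fun x hx => ?_]
    · simpa only [intervalIntegral.integral_zero] using fucikWeight_nonneg n α β
    · rw [uIcc_of_le pi_pos.le] at hx
      simp only [harches.eqOn_sin_nat_mul hn0 hx, sub_self, zero_pow two_ne_zero]
  · rw [hdist hωn.ne' hτn.ne]
    exact (archDistSq_le_archBound_of_gt hn hτ hτn hωn hlen).trans
      (archBound_le_fucikWeight_of_le hn (sqrt_lt_sqrt_iff hq.2.1.le |>.1 (hτn.trans hωn)).le)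
  · rw [hdist hωn.ne hτn.ne']
    exact (archDistSq_le_archBound_of_lt hn hω hωn hτn hlen).trans
      (archBound_le_fucikWeight_of_lt hn (sqrt_lt_sqrt_iff hq.1.le |>.1 (hωn.trans hτn)))

end FucikWeights

section FucikSystems

variable {α β : ℕ → ℝ} {f : ℕ → ℝ → ℝ}

theorem IsFucikSystem.continuousOn (hf : IsFucikSystem α β f) (k : ℕ) :
    ContinuousOn (f (k + 1)) (Icc 0 π) := by
  rcases k with _ | k
  · exact continuous_sin.continuousOn.congr hf.first
  · exact (hf.eigenfunction (k + 2) (by omega)).solution.contDiffOn.continuousOn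

theorem IsFucikSystem.memLp (hf : IsFucikSystem α β f) (𝕜 : Type*) [RCLike 𝕜] (k : ℕ) :
    MemLp (fun x => (f (k + 1) x : 𝕜)) 2 (volume.restrict (Ioo 0 π)) :=
  memLp_ofReal_of_continuousOn (hf.continuousOn k)

theorem IsFucikSystem.norm_toLp_sub_sineLp_sq (hf : IsFucikSystem α β f) (𝕜 : Type*) [RCLike 𝕜]
    (k : ℕ) :
    ‖(hf.memLp 𝕜 k).toLp - sineLp 𝕜 k‖ ^ 2
      = ∫ x in 0..π, (f (k + 1) x - sin ((k + 1 : ℕ) * x)) ^ 2 := by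
  rw [sineLp, norm_toLp_ofReal_sub_sq, ← integral_Ioc_eq_integral_Ioo,
    ← intervalIntegral.integral_of_le pi_pos.le]

theorem IsFucikSystem.norm_toLp_zero_sub_sineLp_sq (hf : IsFucikSystem α β f) (𝕜 : Type*)
    [RCLike 𝕜] : ‖(hf.memLp 𝕜 0).toLp - sineLp 𝕜 0‖ ^ 2 = 0 := by
  rw [hf.norm_toLp_sub_sineLp_sq, intervalIntegral.integral_congr (g := fun _ => 0) fun x hx => ?_,
    intervalIntegral.integral_zero]
  rw [uIcc_of_le pi_pos.le] at hx
  simp only [hf.first hx, zero_add, Nat.cast_one, one_mul, sub_self, zero_pow two_ne_zero]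

theorem IsFucikSystem.norm_toLp_succ_sub_sineLp_sq_le (hf : IsFucikSystem α β f) (𝕜 : Type*)
    [RCLike 𝕜] (k : ℕ) : ‖(hf.memLp 𝕜 (k + 1)).toLp - sineLp 𝕜 (k + 1)‖ ^ 2
      ≤ fucikWeight (k + 2) (α (k + 2)) (β (k + 2)) := by
  rw [hf.norm_toLp_sub_sineLp_sq]
  exact (hf.eigenfunction (k + 2) (by omega)).integral_sub_sin_sq_le_fucikWeight (by omega)
    (hf.mem_curve (k + 2) (by omega))

end FucikSystems

theorem theorem1 {𝕜 : Type*} [RCLike 𝕜] (α β : ℕ → ℝ) (f : ℕ → ℝ → ℝ)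
    (hf : IsFucikSystem α β f)
    (hsummable : Summable fun k : ℕ => fucikWeight (k + 2) (α (k + 2)) (β (k + 2)))
    (hsum : ∑' k : ℕ, fucikWeight (k + 2) (α (k + 2)) (β (k + 2)) < π / 2) :
    ∃ hL2 : ∀ k : ℕ, MemLp (fun x => (f (k + 1) x : 𝕜)) 2 (volume.restrict (Ioo 0 π)),
      IsRieszBasis 𝕜 (fun k : ℕ => (hL2 k).toLp) := by
  have hdist := hf.norm_toLp_succ_sub_sineLp_sq_le 𝕜
  have hs' : Summable fun k => ‖(hf.memLp 𝕜 (k + 1)).toLp - sineLp 𝕜 (k + 1)‖ ^ 2 :=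
    .of_nonneg_of_le (fun _ => sq_nonneg _) hdist hsummable
  have hs : Summable fun k => ‖(hf.memLp 𝕜 k).toLp - sineLp 𝕜 k‖ ^ 2 :=
    (summable_nat_add_iff 1).1 hs'
  have hr : ‖((√(π / 2) : ℝ) : 𝕜)‖ ^ 2 = π / 2 := by
    rw [RCLike.norm_ofReal, sq_abs, sq_sqrt (by positivity)]
  refine ⟨hf.memLp 𝕜, isRieszBasis_of_tsum_norm_sub_smul_sq_lt (sineBasis 𝕜)
    (r := ((√(π / 2) : ℝ) : 𝕜)) ?_ ?_⟩ <;> simp only [sqrt_pi_div_two_smul_sineBasis]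
  · exact hs
  · rw [hr, hs.tsum_eq_zero_add, hf.norm_toLp_zero_sub_sineLp_sq, zero_add]
    exact (hs'.tsum_le_tsum hdist hsummable).trans_lt hsum
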